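/- All structures are finite. \textbf{Logic.} $L_{\infty\omega}(C)$ formulas over a relational vocabulary are built from atomic formulas (including equalities of variables) by negation, conjunctions and disjunctions of arbitrary sets of formulas, the quantifiers $\exists x$, $\forall x$, and the counting quantifiers $(\exists n\,x)$ (``there are at least $n$ elements $x$''). $L^k_{\infty\omega}(C)$ consists of those formulas that use at most $k$ variables in total, free or bound. A formula $\varphi(x,y)$, with $x,y$ distinct, defines a linear order in a structure $M$ if $\{(a,b) : M\models\varphi(a,b)\}$ is a (strict or reflexive) linear order of the whole universe of $M$. \textbf{Hypergraphs.} A hypergraph is a pair $(U,T)$ where $U$ is a nonempty set and $T$ is a set of 3-element subsets of $U$ (hyperedges). For $X\subseteq U$ let $[X]$ be the number of hyperedges contained in $X$. A nonempty set $X\subseteq U$ is dense if $|X|\le 2[X]$. The hypergraph is $l$-meager if it has no dense vertex set of cardinality at most $2l$. \textbf{Multipedes.} A 1-multipede is a directed graph $(U,E)$ such that the domain $D(E)$ (the feet) and the range $R(E)$ (the segments) are disjoint and have union $U$, every foot $a$ has exactly one outgoing edge, leading to its segment $S(a)$, and every segment has exactly two incoming edges (so it has exactly two feet). A $2^-$-multipede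 is a structure $(U,E,T)$ such that $(U,E)$ is a 1-multipede, $(U,T)$ is a hypergraph, each hyperedge consists either of segments only or of feet only, and for each hyperedge $h$ of feet, $S(h)=\{S(a):a\in h\}$ is a hyperedge as well. For a hyperedge $X$ of segments, a slave of $X$ is a 3-element set $A$ of feet with $S(A)=X$; it is positive if it is a hyperedge. Two slaves of $X$ are equivalent if they are equal or one is obtained from the other by permuting the feet of two segments of $X$. A 2-multipede is a $2^-$-multipede in which every hyperedge of segments has exactly four positive slaves, and these are pairwise equivalent. A 3-multipede is a 2-multipede together with a linear order $<$ on its set of segments. A 4-multipede is a 3-multipede together with additional elements (super-segments) that represent uniquely all sets of segments (every set of segments, including the empty one, is represented by exactly one super-segment, and every super-segment represents the set of segments that it contains), and with the corresponding containment relation $\varepsilon$ between segments and super-segments. It is viewed as a structure in the vocabulary $\{E,T,<,\varepsilon\}$, where $T$ is read as the ternary relation $\{(x,y,z):\{x,y,z\}\in T\}$. A 4-multipede is $l$-meager if its hypergraph of segments (the segments with the hyperedges that consist of segments) is $l$-meager. \textbf{Lemma.} There exists a natural number $j$ such that, for every natural number $k$ and every finite $2(j+k)$-meager 4-multipede $M$,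 no $L^k_{\infty\omega}(C)$ formula defines a linear order in $M$. -/

import Mathlib

universe u v w

/-! ### Infinitary logic with counting quantifiers -/

/-- Formulas of infinitary logic with counting quantifiers over a purely relational vocabulary,
with variables named by natural numbers. The only terms are variables. Conjunctions and
disjunctions may be taken over arbitrary families of formulas; the bound on the number of variables
is imposed by `CountingFormula.IsLk`. -/
inductive CountingFormula (L : FirstOrder.Language.{v, v}) : Type (max v (w + 1)) where
  | equal (x y : ℕ) : CountingFormula L
  | rel {n : ℕ} (R : L.Relations n) (xs : Fin n → ℕ) : CountingFormula L
  | not (φ : CountingFormula L) : CountingFormula L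
  | conj {ι : Type w} (φ : ι → CountingFormula L) : CountingFormula L
  | disj {ι : Type w} (φ : ι → CountingFormula L) : CountingFormula L
  | ex (x : ℕ) (φ : CountingFormula L) : CountingFormula L
  | all (x : ℕ) (φ : CountingFormula L) : CountingFormula L
  /-- `exCount n x φ`: there are at least `n` elements `x` such that `φ`. -/
  | exCount (n : ℕ) (x : ℕ) (φ : CountingFormula L) : CountingFormula L

namespace CountingFormula

variable {L : FirstOrder.Language.{v, v}}

/-- All variables that occur in a formula, free or bound. -/
def vars : CountingFormula.{v, w} L → Set ℕ
  | equal x y => {x, y}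
  | rel _ xs => Set.range xs
  | not φ => φ.vars
  | conj φ => ⋃ i, (φ i).vars
  | disj φ => ⋃ i, (φ i).vars
  | ex x φ => insert x φ.vars
  | all x φ => insert x φ.vars
  | exCount _ x φ => insert x φ.vars

/-- The formula is in the `k`-variable fragment: it uses at most `k` variables. -/
def IsLk (k : ℕ) (φ : CountingFormula.{v, w} L) : Prop :=
  φ.vars.encard ≤ k

/-- Satisfaction of a formula in a structure under an assignment of elements to variables. -/
def Realize {M : Type u} [L.Structure M] : CountingFormula.{v, w} L → (ℕ → M) → Prop
  | equal x y, σ => σ x = σ y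
  | rel R xs, σ => FirstOrder.Language.Structure.RelMap R (fun i => σ (xs i))
  | not φ, σ => ¬ φ.Realize σ
  | conj φ, σ => ∀ i, (φ i).Realize σ
  | disj φ, σ => ∃ i, (φ i).Realize σ
  | ex x φ, σ => ∃ a : M, φ.Realize (Function.update σ x a)
  | all x φ, σ => ∀ a : M, φ.Realize (Function.update σ x a)
  | exCount n x φ, σ => (n : ℕ∞) ≤ {a : M | φ.Realize (Function.update σ x a)}.encard

/-- `φ`, read as a formula `φ(x, y)` in two distinct variables, defines the binary relation `r`
on `M`: under every assignment `σ`, the formula holds if and only if `r (σ x) (σ y)`. -/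
def Defines (φ : CountingFormula.{v, w} L) (x y : ℕ) {M : Type u} [L.Structure M]
    (r : M → M → Prop) : Prop :=
  x ≠ y ∧ ∀ σ : ℕ → M, φ.Realize σ ↔ r (σ x) (σ y)

/-- `φ` defines a linear order (strict or reflexive) of the universe of `M`. -/
def DefinesLinearOrder (φ : CountingFormula.{v, w} L) (M : Type u) [L.Structure M] : Prop :=
  ∃ (x y : ℕ) (r : M → M → Prop), φ.Defines x y r ∧ (IsStrictTotalOrder M r ∨ IsLinearOrder M r)

end CountingFormula

/-! ### Hypergraphs with three-element hyperedges -/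

/-- The vertex set is nonempty and every hyperedge has exactly three elements. -/
structure Hypergraph.IsThreeHypergraph {α : Type u} (H : Hypergraph α) : Prop where
  nonempty : H.vertexSet.Nonempty
  ncard_eq : ∀ h ∈ H.edgeSet, h.ncard = 3

/-- The number of hyperedges contained in a finite set `X`. -/
noncomputable def Hypergraph.weight {α : Type u} (H : Hypergraph α) (X : Finset α) : ℕ :=
  {h ∈ H.edgeSet | h ⊆ (X : Set α)}.ncard

/-- A dense vertex set: a nonempty set `X` of vertices with `|X| ≤ 2 [X]`. -/
def Hypergraph.IsDense {α : Type u} (H : Hypergraph α) (X : Finset α) : Prop :=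
  X.Nonempty ∧ (X : Set α) ⊆ H.vertexSet ∧ X.card ≤ 2 * H.weight X

/-- `l`-meager: there are no dense vertex sets of cardinality at most `2l`. -/
def Hypergraph.IsMeager {α : Type u} (H : Hypergraph α) (l : ℕ) : Prop :=
  ∀ X : Finset α, H.IsDense X → ¬ X.card ≤ 2 * l

/-! ### Multipedes

`E a s` says that `a` is a foot of the segment `s`. Since a 4-multipede has elements that are
neither feet nor segments, the universe of a multipede of a lower level is a set in an ambient
type: it is `U` below, or the vertex set of the hypergraph `H`. -/

namespace Multipede

variable {α : Type u}

/-- The domain of `E`. -/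
def feet (E : α → α → Prop) : Set α := {a | ∃ s, E a s}

/-- The range of `E`. -/
def segments (E : α → α → Prop) : Set α := {s | ∃ a, E a s}

/-- The set of the segments of the elements of a set `A` of feet. -/
def segmentSet (E : α → α → Prop) (A : Set α) : Set α := {s | ∃ a ∈ A, E a s}

/-- `(U, E)` is a 1-multipede. -/
structure IsOneMultipede (U : Set α) (E : α → α → Prop) : Prop where
  disjoint : Disjoint (feet E) (segments E)
  union_eq : feet E ∪ segments E = U
  existsUnique_segment : ∀ a ∈ feet E, ∃! s, E a s
  ncard_feet : ∀ s ∈ segments E, {a | E a s}.ncard = 2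

/-- `(U, E, T)` is a 2⁻-multipede, where `(U, T)` is the hypergraph `H`. -/
structure IsTwoMinusMultipede (E : α → α → Prop) (H : Hypergraph α) : Prop where
  isOneMultipede : IsOneMultipede H.vertexSet E
  isThreeHypergraph : H.IsThreeHypergraph
  segments_or_feet : ∀ h ∈ H.edgeSet, h ⊆ segments E ∨ h ⊆ feet E
  segmentSet_mem : ∀ h ∈ H.edgeSet, h ⊆ feet E → segmentSet E h ∈ H.edgeSet

/-- `A` is a slave of `X`: a three-element set of feet whose set of segments is `X`. -/
def IsSlave (E : α → α → Prop) (X A : Set α) : Prop :=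
  A ⊆ feet E ∧ A.ncard = 3 ∧ segmentSet E A = X

/-- Two slaves of `X` are equivalent if they are identical or one is obtained from the other by
permuting the feet of two segments `s`, `t` of `X`. -/
def SlaveEquiv (E : α → α → Prop) (X A B : Set α) : Prop :=
  A = B ∨ ∃ s ∈ X, ∃ t ∈ X, s ≠ t ∧ ∀ a ∈ feet E,
    (E a s ∨ E a t → (a ∈ B ↔ a ∉ A)) ∧ (¬ (E a s ∨ E a t) → (a ∈ B ↔ a ∈ A))

/-- The positive slaves of `X`: those that are hyperedges. -/
def positiveSlaves (E : α → α → Prop) (H : Hypergraph α) (X : Set α) : Set (Set α) :=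
  {A | IsSlave E X A ∧ A ∈ H.edgeSet}

/-- `(U, E, T)` is a 2-multipede, where `(U, T)` is the hypergraph `H`. -/
structure IsTwoMultipede (E : α → α → Prop) (H : Hypergraph α) : Prop where
  isTwoMinusMultipede : IsTwoMinusMultipede E H
  ncard_positive : ∀ X ∈ H.edgeSet, X ⊆ segments E → (positiveSlaves E H X).ncard = 4
  positive_equiv : ∀ X ∈ H.edgeSet, X ⊆ segments E →
    ∀ A ∈ positiveSlaves E H X, ∀ B ∈ positiveSlaves E H X, SlaveEquiv E X A B

/-- `(U, E, T, <)` is a 3-multipede: a 2-multipede with a linear order on the set of segments. -/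
structure IsThreeMultipede (E : α → α → Prop) (H : Hypergraph α) (lt : α → α → Prop) : Prop where
  isTwoMultipede : IsTwoMultipede E H
  lt_mem : ∀ s t, lt s t → s ∈ segments E ∧ t ∈ segments E
  isStrictTotalOrder : IsStrictTotalOrder (segments E) (fun s t => lt s t)

/-- The relation symbols of the vocabulary of 4-multipedes. -/
inductive Symbols : ℕ → Type
  | edge : Symbols 2
  | hyperedge : Symbols 3
  | lt : Symbols 2
  | mem : Symbols 2

/-- The vocabulary of 4-multipedes: purely relational. -/
def language : FirstOrder.Language.{0, 0} := ⟨fun _ => Empty, Symbols⟩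

end Multipede

open Multipede in
/-- A 4-multipede: a 3-multipede `(U, E, T, <)`, where `(U, T)` is the hypergraph `H`, together with
additional elements (super-segments) that represent uniquely all sets of segments, and the
containment relation `mem` between segments and super-segments. -/
structure FourMultipede where
  carrier : Type u
  E : carrier → carrier → Prop
  H : Hypergraph carrier
  lt : carrier → carrier → Prop
  mem : carrier → carrier → Prop
  isThreeMultipede : IsThreeMultipede E H lt
  mem_segment : ∀ s Y, mem s Y → s ∈ segments E ∧ Y ∉ H.vertexSet
  existsUnique_superSegment : ∀ S : Set carrier, S ⊆ segments E →
    ∃! Y, Y ∉ H.vertexSet ∧ ∀ s, mem s Y ↔ s ∈ S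

namespace FourMultipede

open Multipede

/-- A 4-multipede as a structure of its vocabulary; the hyperedges form a ternary relation. -/
instance (M : FourMultipede.{u}) : language.Structure M.carrier where
  funMap f := f.elim
  RelMap R := match R with
    | .edge => fun xs => M.E (xs 0) (xs 1)
    | .hyperedge => fun xs => {xs 0, xs 1, xs 2} ∈ M.H.edgeSet
    | .lt => fun xs => M.lt (xs 0) (xs 1)
    | .mem => fun xs => M.mem (xs 0) (xs 1)

/-- The hypergraph of segments. -/
def segmentHypergraph (M : FourMultipede.{u}) : Hypergraph M.carrier where
  vertexSet := segments M.E
  edgeSet := {h ∈ M.H.edgeSet | h ⊆ segments M.E}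
  subset_vertexSet_of_mem_edgeSet' _ h := h.2

/-- A 4-multipede is `l`-meager if its hypergraph of segments is. -/
def IsMeager (M : FourMultipede.{u}) (l : ℕ) : Prop :=
  M.segmentHypergraph.IsMeager l

end FourMultipede

/-! ### Systems of triples without small dense sets -/

namespace TripleSystem

variable {α : Type u}

/-! The two feet of a segment cannot be told apart by few variables. A function `g` from segments to
`ZMod 2` induces a flip, which exchanges the feet of each segment with `g s ≠ 0` and fixes segments
and super-segments. Every flip respects `E`, `<` and `ε`, and it respects the hyperedges of feet
over a triple on which `g` sums to zero (`hyperedge_flip`). So locally, isomorphisms are solutions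
of a linear system over `ZMod 2` with one equation per hyperedge of segments.

Meagerness makes this system solvable step by step. The closure of a small set at most doubles its
size (`card_closure_le`), and a solution on a closed set extends to any small superset
(`exists_extension`). Hence assignments that differ by a flip solving the equations on the closure
of their segments form a back-and-forth system with bijections (`FlipEquiv.exists_equiv`), so they
satisfy the same formulas (`FlipEquiv.realize_iff`). The closure of one segment contains no triple,
so its two feet may be exchanged, and a definable relation holds for them in both orders or in
neither. No linear order does that. -/

/-- The assignment `g` sums up to zero on every triple contained in `Y`. -/
def SumsToZero (T : Finset (Finset α)) (Y : Finset α) (g : α → ZMod 2) : Prop :=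
  ∀ h ∈ T, h ⊆ Y → ∑ v ∈ h, g v = 0

theorem SumsToZero.mono {T : Finset (Finset α)} {Y Z : Finset α} {g : α → ZMod 2}
    (hg : SumsToZero T Z g) (hYZ : Y ⊆ Z) : SumsToZero T Y g :=
  fun h hT hY => hg h hT (hY.trans hYZ)

variable [DecidableEq α]

/-- Every nonempty set of at most `2 * l` vertices contains few triples. -/
def Meager (T : Finset (Finset α)) (l : ℕ) : Prop :=
  ∀ X : Finset α, X.Nonempty → X.card ≤ 2 * l → 2 * (T.filter (· ⊆ X)).card < X.card

/-- A set is closed if it contains every triple of which it contains two vertices. -/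
def Closed (T : Finset (Finset α)) (Y : Finset α) : Prop :=
  ∀ h ∈ T, 2 ≤ (h ∩ Y).card → h ⊆ Y

/-- In a meager system, some vertex of `Z` outside a closed set `Y` lies in at most one triple
contained in `Z`. -/
theorem exists_degree_le_one {T : Finset (Finset α)} (hT : ∀ h ∈ T, h.card = 3) {l : ℕ}
    (hl : Meager T l) {Y Z : Finset α} (hY : Closed T Y) (hZ : Z.card ≤ 2 * l)
    (hne : (Z \ Y).Nonempty) :
    ∃ v ∈ Z \ Y, (T.filter (fun h => h ⊆ Z ∧ v ∈ h)).card ≤ 1 := by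
  by_contra! hdeg
  -- If every vertex of `Z \ Y` has degree at least two, the set `V` below is dense. A triple of `C`
  -- meets the closed set `Y` in at most one vertex, so `|h \ Y| + 2|h ∩ Y| = 3 + |h ∩ Y| ≤ 4`.
  -- Summing over `C` gives `2|V| ≤ 4|C|`, where all triples of `C` lie in `V`.
  set C := T.filter (fun h => h ⊆ Z ∧ ¬ h ⊆ Y) with hC
  have hinter : ∀ h ∈ C, (h ∩ Y).card ≤ 1 := by
    intro h hh
    simp only [hC, Finset.mem_filter] at hh
    by_contra! hcon
    exact hh.2.2 (hY h hh.1 hcon)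
  have hdiff : ∀ h ∈ C, (h \ Y).card + (h ∩ Y).card = 3 := by
    intro h hh
    rw [Finset.card_sdiff_add_card_inter]
    exact hT h (Finset.mem_filter.1 hh).1
  set V := (Z \ Y) ∪ C.biUnion (fun h => h ∩ Y) with hV
  have hcount : ∑ v ∈ Z \ Y, (C.filter (fun h => v ∈ h)).card = ∑ h ∈ C, (h \ Y).card := by
    simp only [Finset.card_filter]
    rw [Finset.sum_comm]
    refine Finset.sum_congr rfl fun h hh => ?_
    rw [← Finset.card_filter]
    congr 1
    ext v
    have hhZ := (Finset.mem_filter.1 hh).2.1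
    simp only [Finset.mem_filter, Finset.mem_sdiff]
    exact ⟨fun hv => ⟨hv.2, hv.1.2⟩, fun hv => ⟨⟨hhZ hv.1, hv.2⟩, hv.1⟩⟩
  have htwo : 2 * (Z \ Y).card ≤ ∑ h ∈ C, (h \ Y).card := by
    rw [← hcount, mul_comm, ← smul_eq_mul]
    refine Finset.card_nsmul_le_sum _ _ _ fun v hv => ?_
    refine (hdeg v hv).trans_le (Finset.card_le_card fun h hh => ?_)
    simp only [hC, Finset.mem_filter] at hh ⊢
    exact ⟨⟨hh.1, hh.2.1, fun hhY => (Finset.mem_sdiff.1 hv).2 (hhY hh.2.2)⟩, hh.2.2⟩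
  have hVcard : V.card ≤ (Z \ Y).card + ∑ h ∈ C, (h ∩ Y).card :=
    (Finset.card_union_le _ _).trans (Nat.add_le_add_left Finset.card_biUnion_le _)
  have hsum : ∑ h ∈ C, (h \ Y).card + 2 * ∑ h ∈ C, (h ∩ Y).card ≤ 4 * C.card := by
    rw [Finset.mul_sum, ← Finset.sum_add_distrib, mul_comm, ← smul_eq_mul]
    refine Finset.sum_le_card_nsmul _ _ _ fun h hh => ?_
    have := hinter h hh
    have := hdiff h hh
    omega
  have hVZ : V ⊆ Z := by
    refine Finset.union_subset Finset.sdiff_subset (Finset.biUnion_subset.2 fun h hh => ?_)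
    exact Finset.inter_subset_left.trans (Finset.mem_filter.1 hh).2.1
  have hCV : C.card ≤ (T.filter (· ⊆ V)).card := by
    refine Finset.card_le_card fun h hh => ?_
    have hh' := Finset.mem_filter.1 hh
    refine Finset.mem_filter.2 ⟨hh'.1, fun v hv => ?_⟩
    by_cases hvY : v ∈ Y
    · exact Finset.mem_union_right _
        (Finset.mem_biUnion.2 ⟨h, hh, Finset.mem_inter.2 ⟨hv, hvY⟩⟩)
    · exact Finset.mem_union_left _ (Finset.mem_sdiff.2 ⟨hh'.2.1 hv, hvY⟩)
  have := hl V (hne.mono Finset.subset_union_left) ((Finset.card_le_card hVZ).trans hZ)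
  omega

/-- In a meager system, a solution on a closed set extends to every small superset. -/
theorem exists_extension {T : Finset (Finset α)} (hT : ∀ h ∈ T, h.card = 3) {l : ℕ}
    (hl : Meager T l) {Y : Finset α} (hY : Closed T Y) {g : α → ZMod 2}
    (hg : SumsToZero T Y g) (Z : Finset α) (hYZ : Y ⊆ Z) (hZ : Z.card ≤ 2 * l) :
    ∃ g' : α → ZMod 2, SumsToZero T Z g' ∧ ∀ v ∈ Y, g' v = g v := by
  induction Z using Finset.strongInduction with
  | H Z ih =>
    rcases (Z \ Y).eq_empty_or_nonempty with hemp | hne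
    · exact ⟨g, hg.mono (Finset.sdiff_eq_empty_iff_subset.1 hemp), fun _ _ => rfl⟩
    obtain ⟨v, hv, hdeg⟩ := exists_degree_le_one hT hl hY hZ hne
    obtain ⟨hvZ, hvY⟩ := Finset.mem_sdiff.1 hv
    obtain ⟨g₁, hg₁, hext⟩ := ih (Z.erase v) (Finset.erase_ssubset hvZ)
      (Finset.subset_erase.2 ⟨hYZ, hvY⟩)
      ((Finset.card_le_card (Finset.erase_subset _ _)).trans hZ)
    have hrest : ∀ (c : ZMod 2) (h : Finset α), h ∈ T → h ⊆ Z → v ∉ h →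
        ∑ w ∈ h, Function.update g₁ v c w = 0 := by
      intro c h hh hhZ hvh
      rw [Finset.sum_update_of_notMem hvh]
      exact hg₁ h hh (Finset.subset_erase.2 ⟨hhZ, hvh⟩)
    have hupd : ∀ (c : ZMod 2), ∀ w ∈ Y, Function.update g₁ v c w = g w := by
      intro c w hw
      rw [Function.update_of_ne (ne_of_mem_of_not_mem hw hvY), hext w hw]
    by_cases hex : ∃ h₀ ∈ T, h₀ ⊆ Z ∧ v ∈ h₀
    · obtain ⟨h₀, hh₀, hh₀Z, hvh₀⟩ := hex
      -- Only one equation involves `v`, and it is solved for the value at `v`.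
      refine ⟨Function.update g₁ v (-∑ w ∈ h₀ \ {v}, g₁ w), fun h hh hhZ => ?_, hupd _⟩
      by_cases hvh : v ∈ h
      · have : h = h₀ := Finset.card_le_one.1 hdeg h (by simp [hh, hhZ, hvh]) h₀
          (by simp [hh₀, hh₀Z, hvh₀])
        rw [this, Finset.sum_update_of_mem hvh₀, neg_add_cancel]
      · exact hrest _ h hh hhZ hvh
    · push Not at hex
      exact ⟨Function.update g₁ v 0, fun h hh hhZ => hrest 0 h hh hhZ (hex h hh hhZ), hupd 0⟩

/-! ### Closures and their size -/

variable [Fintype α]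

open scoped Classical in
/-- The least closed superset of `A`. -/
noncomputable def closure (T : Finset (Finset α)) (A : Finset α) : Finset α :=
  Finset.univ.filter fun v => ∀ Y, Closed T Y → A ⊆ Y → v ∈ Y

theorem subset_closure (T : Finset (Finset α)) (A : Finset α) : A ⊆ closure T A := by
  intro v hv
  simp only [closure, Finset.mem_filter, Finset.mem_univ, true_and]
  exact fun Y _ hA => hA hv

theorem closure_subset {T : Finset (Finset α)} {A Y : Finset α} (hY : Closed T Y) (hA : A ⊆ Y) :
    closure T A ⊆ Y :=
  fun v hv => by
    simp only [closure, Finset.mem_filter, Finset.mem_univ, true_and] at hv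
    exact hv Y hY hA

theorem closed_closure (T : Finset (Finset α)) (A : Finset α) : Closed T (closure T A) := by
  intro h hh hcard v hv
  simp only [closure, Finset.mem_filter, Finset.mem_univ, true_and]
  intro Y hY hA
  exact hY h hh (hcard.trans (Finset.card_le_card
    (Finset.inter_subset_inter_left (closure_subset hY hA)))) hv

theorem closure_mono (T : Finset (Finset α)) {A B : Finset α} (h : A ⊆ B) :
    closure T A ⊆ closure T B :=
  closure_subset (closed_closure T B) (h.trans (subset_closure T B))

/-- In a meager system, the closure of a small set is at most twice as large. -/
theorem card_closure_le {T : Finset (Finset α)} (hT : ∀ h ∈ T, h.card = 3) {l : ℕ}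
    (hl : Meager T l) (A : Finset α) (hA : A.card < l) :
    (closure T A).card ≤ 2 * A.card := by
  classical
  -- Building the closure adds one vertex per new triple, which is the invariant `|Z| ≤ |A| + [Z]`.
  -- A largest member of `F` is closed.
  let F : Finset (Finset α) := Finset.univ.filter fun Z =>
    A ⊆ Z ∧ Z ⊆ closure T A ∧ Z.card ≤ 2 * A.card ∧ Z.card ≤ A.card + (T.filter (· ⊆ Z)).card
  have hAF : A ∈ F := by
    simp only [F, Finset.mem_filter, Finset.mem_univ, true_and]
    exact ⟨subset_rfl, subset_closure T A, by omega, by omega⟩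
  obtain ⟨Z, hZF, hmax⟩ := F.exists_max_image Finset.card ⟨A, hAF⟩
  simp only [F, Finset.mem_filter, Finset.mem_univ, true_and] at hZF hmax
  obtain ⟨hAZ, hZcl, hZ2, hZT⟩ := hZF
  have hclosed : Closed T Z := by
    intro h hh hcard
    by_contra hhZ
    have hlt : (h ∩ Z).card < h.card := Finset.card_lt_card
      ⟨Finset.inter_subset_left, fun hsub => hhZ (hsub.trans Finset.inter_subset_right)⟩
    have h3 := hT h hh
    have hunion := Finset.card_union_add_card_inter h Z
    have hfilter : (T.filter (· ⊆ Z)).card + 1 ≤ (T.filter (· ⊆ h ∪ Z)).card := by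
      refine Finset.card_lt_card ⟨fun e he => ?_, fun hsub => ?_⟩
      · simp only [Finset.mem_filter] at he ⊢
        exact ⟨he.1, he.2.trans Finset.subset_union_right⟩
      · have : h ∈ T.filter (· ⊆ Z) :=
          hsub (Finset.mem_filter.2 ⟨hh, Finset.subset_union_left⟩)
        exact hhZ (Finset.mem_filter.1 this).2
    -- Here `|h ∪ Z| ≤ 2|A| + 1 ≤ 2l`, so meagerness applies. With the invariant it gives `2[h ∪ Z]
    -- < |A| + [h ∪ Z]`, hence `|h ∪ Z| < 2|A|`: the enlarged set is still in `F`.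
    have hmeager := hl (h ∪ Z) (Finset.card_pos.1 (by omega)) (by omega)
    have := hmax (h ∪ Z) ⟨hAZ.trans Finset.subset_union_right,
      Finset.union_subset (closed_closure T A h hh (hcard.trans (Finset.card_le_card
        (Finset.inter_subset_inter_left hZcl)))) hZcl, by omega, by omega⟩
    omega
  exact (Finset.card_le_card (closure_subset hclosed hAZ)).trans hZ2

end TripleSystem

/-! ### Flipping the feet of segments -/

namespace FourMultipede

open Multipede TripleSystem

variable (M : FourMultipede.{u})

theorem isOneMultipede : IsOneMultipede M.H.vertexSet M.E :=
  M.isThreeMultipede.isTwoMultipede.isTwoMinusMultipede.isOneMultipede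

open scoped Classical in
/-- The segment of a foot; the element itself if it is not a foot. -/
noncomputable def seg (a : M.carrier) : M.carrier :=
  if h : ∃ s, M.E a s then h.choose else a

variable {M} in
theorem seg_eq {a s : M.carrier} (h : M.E a s) : M.seg a = s := by
  have hex : ∃ s, M.E a s := ⟨s, h⟩
  rw [seg, dif_pos hex]
  exact (M.isOneMultipede.existsUnique_segment a hex).unique hex.choose_spec h

variable {M} in
theorem exists_other_foot {a s : M.carrier} (h : M.E a s) :
    ∃ b, b ≠ a ∧ ∀ c, M.E c s ↔ c = a ∨ c = b := by
  obtain ⟨x, y, hxy, hset⟩ := Set.ncard_eq_two.1 (M.isOneMultipede.ncard_feet s ⟨a, h⟩)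
  have hiff : ∀ c, M.E c s ↔ c = x ∨ c = y := fun c => by
    simpa using Set.ext_iff.1 hset c
  rcases (hiff a).1 h with rfl | rfl
  · exact ⟨y, hxy.symm, hiff⟩
  · exact ⟨x, hxy, fun c => (hiff c).trans or_comm⟩

open scoped Classical in
/-- The other foot of the same segment; the element itself if it is not a foot. -/
noncomputable def partner (a : M.carrier) : M.carrier :=
  if h : ∃ s, M.E a s then (exists_other_foot h.choose_spec).choose else a

variable {M}

theorem partner_spec {a s : M.carrier} (h : M.E a s) :
    M.partner a ≠ a ∧ ∀ c, M.E c s ↔ c = a ∨ c = M.partner a := by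
  have hex : ∃ s, M.E a s := ⟨s, h⟩
  have hs : hex.choose = s :=
    (M.isOneMultipede.existsUnique_segment a hex).unique hex.choose_spec h
  have := (exists_other_foot hex.choose_spec).choose_spec
  rw [partner, dif_pos hex]
  refine ⟨this.1, fun c => ?_⟩
  rw [← this.2 c, hs]

theorem edge_partner {a s : M.carrier} (h : M.E a s) : M.E (M.partner a) s :=
  ((partner_spec h).2 _).2 (Or.inr rfl)

theorem partner_of_not_foot {a : M.carrier} (h : ¬ ∃ s, M.E a s) : M.partner a = a := by
  rw [partner, dif_neg h]

theorem partner_partner (a : M.carrier) : M.partner (M.partner a) = a := by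
  by_cases h : ∃ s, M.E a s
  · obtain ⟨s, hs⟩ := h
    rcases ((partner_spec hs).2 _).1 (edge_partner (edge_partner hs)) with h' | h'
    · exact h'
    · exact absurd h' (partner_spec (edge_partner hs)).1
  · rw [partner_of_not_foot h, partner_of_not_foot h]

theorem seg_partner (a : M.carrier) : M.seg (M.partner a) = M.seg a := by
  by_cases h : ∃ s, M.E a s
  · obtain ⟨s, hs⟩ := h
    rw [seg_eq hs, seg_eq (edge_partner hs)]
  · rw [partner_of_not_foot h]

open scoped Classical in
/-- Permute the feet of all segments `s` with `g s ≠ 0`. -/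
noncomputable def flip (g : M.carrier → ZMod 2) (a : M.carrier) : M.carrier :=
  if g (M.seg a) = 0 then a else M.partner a

theorem flip_of_not_foot (g : M.carrier → ZMod 2) {a : M.carrier} (h : ¬ ∃ s, M.E a s) :
    flip g a = a := by
  rw [flip, partner_of_not_foot h, ite_self]

theorem seg_flip (g : M.carrier → ZMod 2) (a : M.carrier) : M.seg (flip g a) = M.seg a := by
  unfold flip
  split_ifs
  · rfl
  · exact seg_partner a

/-- A flip keeps every foot on its segment, so the second application makes the same choice as the
first. -/
theorem flip_flip (g : M.carrier → ZMod 2) (a : M.carrier) : flip g (flip g a) = a := by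
  by_cases h : g (M.seg a) = 0
  · simp [flip, h]
  · simp [flip, h, seg_partner, partner_partner]

theorem flip_congr {g g' : M.carrier → ZMod 2} {a : M.carrier} (h : g (M.seg a) = g' (M.seg a)) :
    flip g a = flip g' a := by
  rw [flip, flip, h]

theorem not_foot_of_segment {s : M.carrier} (h : s ∈ segments M.E) : ¬ ∃ t, M.E s t :=
  fun hs => Set.disjoint_left.1 M.isOneMultipede.disjoint hs h

theorem not_foot_of_notMem {Y : M.carrier} (h : Y ∉ M.H.vertexSet) : ¬ ∃ t, M.E Y t :=
  fun hs => h (M.isOneMultipede.union_eq ▸ Or.inl hs)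

theorem edge_flip (g : M.carrier → ZMod 2) {a s : M.carrier} (h : M.E a s) :
    M.E (flip g a) (flip g s) := by
  rw [flip_of_not_foot g (not_foot_of_segment ⟨a, h⟩)]
  unfold flip
  split_ifs
  · exact h
  · exact edge_partner h

theorem lt_flip (g : M.carrier → ZMod 2) {s t : M.carrier} (h : M.lt s t) :
    M.lt (flip g s) (flip g t) := by
  have hmem := M.isThreeMultipede.lt_mem s t h
  rwa [flip_of_not_foot g (not_foot_of_segment hmem.1),
    flip_of_not_foot g (not_foot_of_segment hmem.2)]

theorem mem_flip (g : M.carrier → ZMod 2) {s Y : M.carrier} (h : M.mem s Y) :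
    M.mem (flip g s) (flip g Y) := by
  have hmem := M.mem_segment s Y h
  rwa [flip_of_not_foot g (not_foot_of_segment hmem.1),
    flip_of_not_foot g (not_foot_of_notMem hmem.2)]

/-! ### Positive slaves -/

theorem not_mem_triple_partner {a b c : M.carrier} (ha : ∃ s, M.E a s)
    (hab : M.seg a ≠ M.seg b) (hac : M.seg a ≠ M.seg c) :
    M.partner a ∉ ({a, b, c} : Set M.carrier) := by
  obtain ⟨s, hs⟩ := ha
  rintro (h | h | h)
  · exact (partner_spec hs).1 h
  · exact hab (by rw [← h, seg_partner])
  · exact hac (by rw [← h, seg_partner])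

/-- A three-element set obtained from `{a, b, c}` by permuting the feet of two segments. -/
theorem eq_of_permuted {a b c s t r : M.carrier} (ha : M.E a s) (hb : M.E b t) (hc : M.E c r)
    (hst : s ≠ t) (hsr : s ≠ r) (htr : t ≠ r) {B : Set M.carrier} (hB : B.ncard = 3)
    (h : ∀ d ∈ feet M.E, (M.E d s ∨ M.E d t → (d ∈ B ↔ d ∉ ({a, b, c} : Set M.carrier))) ∧
      (¬ (M.E d s ∨ M.E d t) → (d ∈ B ↔ d ∈ ({a, b, c} : Set M.carrier)))) :
    B = {M.partner a, M.partner b, c} := by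
  have hsa := seg_eq ha
  have hsb := seg_eq hb
  have hsc := seg_eq hc
  have hpa := edge_partner ha
  have hpb := edge_partner hb
  have hpaB : M.partner a ∈ B := ((h _ ⟨s, hpa⟩).1 (Or.inl hpa)).2
    (not_mem_triple_partner ⟨s, ha⟩ (by rwa [hsa, hsb]) (by rwa [hsa, hsc]))
  have hpbB : M.partner b ∈ B := ((h _ ⟨t, hpb⟩).1 (Or.inr hpb)).2 <| by
    have := not_mem_triple_partner (b := a) (c := c) ⟨t, hb⟩ (by rw [hsa, hsb]; exact hst.symm)
      (by rwa [hsb, hsc])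
    rwa [Set.insert_comm]
  have hcB : c ∈ B := ((h c ⟨r, hc⟩).2 (by
    rintro (h' | h')
    · exact hsr ((seg_eq h').symm.trans hsc)
    · exact htr ((seg_eq h').symm.trans hsc))).2 (by simp)
  have hne1 : M.partner a ≠ M.partner b := fun h' =>
    hst (by rw [← seg_eq hpa, h', seg_eq hpb])
  have hne2 : M.partner a ≠ c := fun h' => hsr (by rw [← seg_eq hpa, h', hsc])
  have hne3 : M.partner b ≠ c := fun h' => htr (by rw [← seg_eq hpb, h', hsc])
  refine (Set.eq_of_subset_of_ncard_le ?_ ?_ (Set.finite_of_ncard_pos (by omega))).symm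
  · rintro d (rfl | rfl | rfl) <;> assumption
  · rw [hB, Set.ncard_eq_three.2 ⟨_, _, _, hne1, hne2, hne3, rfl⟩]

/-- A set obtained from a hyperedge of feet by permuting the feet of two segments is a hyperedge. -/
theorem permuted_mem_edgeSet {a b c s t r : M.carrier} (ha : M.E a s) (hb : M.E b t)
    (hc : M.E c r) (hst : s ≠ t) (hsr : s ≠ r) (htr : t ≠ r)
    (habc : ({a, b, c} : Set M.carrier) ∈ M.H.edgeSet)
    (hseg : ({s, t, r} : Set M.carrier) ∈ M.H.edgeSet) :
    ({M.partner a, M.partner b, c} : Set M.carrier) ∈ M.H.edgeSet ∧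
    ({M.partner a, b, M.partner c} : Set M.carrier) ∈ M.H.edgeSet ∧
    ({a, M.partner b, M.partner c} : Set M.carrier) ∈ M.H.edgeSet := by
  classical
  have htwo := M.isThreeMultipede.isTwoMultipede
  have hsub : ({s, t, r} : Set M.carrier) ⊆ segments M.E := by
    rintro _ (rfl | rfl | rfl)
    exacts [⟨a, ha⟩, ⟨b, hb⟩, ⟨c, hc⟩]
  have hslave : IsSlave M.E {s, t, r} {a, b, c} := by
    refine ⟨?_, htwo.isTwoMinusMultipede.isThreeHypergraph.ncard_eq _ habc, ?_⟩
    · rintro _ (rfl | rfl | rfl)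
      exacts [⟨s, ha⟩, ⟨t, hb⟩, ⟨r, hc⟩]
    · ext x
      constructor
      · rintro ⟨d, rfl | rfl | rfl, hd⟩
        · left; rw [← seg_eq hd, seg_eq ha]
        · right; left; rw [← seg_eq hd, seg_eq hb]
        · right; right; rw [Set.mem_singleton_iff, ← seg_eq hd, seg_eq hc]
      · rintro (rfl | rfl | rfl)
        exacts [⟨a, by simp, ha⟩, ⟨b, by simp, hb⟩, ⟨c, by simp, hc⟩]
  -- The slaves equivalent to `{a, b, c}` are among these four, and there are exactly four positive
  -- slaves, all equivalent. So the inclusion in `Q` is an equality.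
  let Q : Finset (Set M.carrier) := {{a, b, c}, {M.partner a, M.partner b, c},
    {M.partner a, b, M.partner c}, {a, M.partner b, M.partner c}}
  have hPQ : positiveSlaves M.E M.H {s, t, r} ⊆ (Q : Set (Set M.carrier)) := by
    intro B hB
    have hB3 : B.ncard = 3 := hB.1.2.1
    have h1 := @eq_of_permuted M a b c s t r ha hb hc hst hsr htr B hB3
    have h2 := @eq_of_permuted M a c b s r t ha hc hb hsr hst htr.symm B hB3
    have h3 := @eq_of_permuted M b c a t r s hb hc ha htr hst.symm hsr.symm B hB3
    have e2 : ({a, c, b} : Set M.carrier) = {a, b, c} := by rw [Set.pair_comm c b]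
    have e3 : ({b, c, a} : Set M.carrier) = {a, b, c} := by
      rw [Set.pair_comm c a, Set.insert_comm]
    have f2 : ({M.partner a, M.partner c, b} : Set M.carrier) = {M.partner a, b, M.partner c} := by
      rw [Set.pair_comm]
    have f3 : ({M.partner b, M.partner c, a} : Set M.carrier) =
        {a, M.partner b, M.partner c} := by
      rw [Set.pair_comm _ a, Set.insert_comm]
    rw [e2, f2] at h2
    rw [e3, f3] at h3
    simp only [Q, Finset.coe_insert, Finset.coe_singleton, Set.mem_insert_iff,
      Set.mem_singleton_iff]
    rcases htwo.positive_equiv _ hseg hsub _ ⟨hslave, habc⟩ B hB with rfl | ⟨x, hx, y, hy, hxy, h⟩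
    · exact Or.inl rfl
    have h' : ∀ d ∈ feet M.E, (M.E d y ∨ M.E d x → (d ∈ B ↔ d ∉ ({a, b, c} : Set M.carrier))) ∧
        (¬ (M.E d y ∨ M.E d x) → (d ∈ B ↔ d ∈ ({a, b, c} : Set M.carrier))) :=
      fun d hd => by rw [or_comm]; exact h d hd
    rcases hx with rfl | rfl | rfl <;> rcases hy with rfl | rfl | rfl
    · exact absurd rfl hxy
    · exact Or.inr (Or.inl (h1 h))
    · exact Or.inr (Or.inr (Or.inl (h2 h)))
    · exact Or.inr (Or.inl (h1 h'))
    · exact absurd rfl hxy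
    · exact Or.inr (Or.inr (Or.inr (h3 h)))
    · exact Or.inr (Or.inr (Or.inl (h2 h')))
    · exact Or.inr (Or.inr (Or.inr (h3 h')))
    · exact absurd rfl hxy
  have heq := Set.eq_of_subset_of_ncard_le hPQ (by
    rw [htwo.ncard_positive _ hseg hsub, Set.ncard_coe_finset]
    exact Finset.card_le_four) Q.finite_toSet
  have hQ : ∀ B ∈ Q, B ∈ M.H.edgeSet := fun B hB => by
    have : B ∈ positiveSlaves M.E M.H {s, t, r} := heq ▸ Finset.mem_coe.2 hB
    exact this.2
  exact ⟨hQ _ (by simp [Q]), hQ _ (by simp [Q]), hQ _ (by simp [Q])⟩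

/-! ### Flips preserve the structure locally -/

section Finite

variable [Fintype M.carrier]

variable (M) in
open scoped Classical in
/-- The hyperedges of segments. -/
noncomputable def triples : Finset (Finset M.carrier) :=
  Finset.univ.filter fun h => (h : Set M.carrier) ∈ M.segmentHypergraph.edgeSet

theorem mem_triples {h : Finset M.carrier} :
    h ∈ M.triples ↔ (h : Set M.carrier) ∈ M.H.edgeSet ∧ (h : Set M.carrier) ⊆ segments M.E := by
  classical
  unfold triples
  rw [Finset.mem_filter]
  exact ⟨fun h => h.2, fun h => ⟨Finset.mem_univ _, h⟩⟩

theorem card_of_mem_triples {h : Finset M.carrier} (hh : h ∈ M.triples) : h.card = 3 := by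
  rw [← Set.ncard_coe_finset]
  exact M.isThreeMultipede.isTwoMultipede.isTwoMinusMultipede.isThreeHypergraph.ncard_eq _
    (mem_triples.1 hh).1

open scoped Classical in
-- Elements other than segments lie in no triple, so discarding them from `X` leaves the triples
-- unchanged and only shrinks `X`. This allows `seg` to take values that are not segments.
theorem IsMeager.meager_triples {l : ℕ} (hM : M.IsMeager l) : Meager M.triples l := by
  intro X hX hcard
  set X' := X.filter (· ∈ segments M.E) with hX'
  have hfilter : M.triples.filter (· ⊆ X) = M.triples.filter (· ⊆ X') := by
    ext h
    simp only [Finset.mem_filter, and_congr_right_iff]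
    intro hh
    refine ⟨fun hs v hv => Finset.mem_filter.2 ⟨hs hv, (mem_triples.1 hh).2 hv⟩,
      fun hs => hs.trans (Finset.filter_subset _ _)⟩
  have hle : X'.card ≤ X.card := Finset.card_le_card (Finset.filter_subset _ _)
  have hweight : M.segmentHypergraph.weight X' = (M.triples.filter (· ⊆ X')).card := by
    rw [Hypergraph.weight, ← Set.ncard_coe_finset,
      ← Set.ncard_image_of_injective _ Finset.coe_injective]
    congr 1
    ext h
    constructor
    · rintro ⟨h1, h2⟩
      have hfin := Set.toFinite h
      refine ⟨hfin.toFinset, ?_, hfin.coe_toFinset⟩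
      rw [Finset.mem_coe, Finset.mem_filter, triples, Finset.mem_filter]
      refine ⟨⟨Finset.mem_univ _, by rwa [hfin.coe_toFinset]⟩, ?_⟩
      rwa [← Finset.coe_subset, hfin.coe_toFinset]
    · rintro ⟨f, hf, rfl⟩
      rw [Finset.mem_coe, Finset.mem_filter, triples, Finset.mem_filter] at hf
      exact ⟨hf.1.2, Finset.coe_subset.2 hf.2⟩
  rw [hfilter]
  rcases X'.eq_empty_or_nonempty with hemp | hne
  · have : M.triples.filter (· ⊆ X') = ∅ := by
      refine Finset.filter_eq_empty_iff.2 fun h hh hs => ?_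
      have := card_of_mem_triples hh
      rw [hemp, Finset.subset_empty] at hs
      simp [hs] at this
    rw [this]
    simpa using hX
  · by_contra! hcon
    refine hM X' ⟨hne, fun v hv => (Finset.mem_filter.1 hv).2, ?_⟩ (hle.trans hcard)
    rw [hweight]
    exact hle.trans hcon

open scoped Classical in
-- A zero sum modulo 2 means that none or exactly two of the three segments are flipped, so a
-- positive slave goes to an equivalent one, which is again positive. Hyperedges of segments are
-- fixed pointwise.
theorem hyperedge_flip {g : M.carrier → ZMod 2} {Y : Finset M.carrier}
    (hg : SumsToZero M.triples Y g) {a b c : M.carrier} (ha : M.seg a ∈ Y) (hb : M.seg b ∈ Y)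
    (hc : M.seg c ∈ Y) (habc : ({a, b, c} : Set M.carrier) ∈ M.H.edgeSet) :
    ({flip g a, flip g b, flip g c} : Set M.carrier) ∈ M.H.edgeSet := by
  have htwo := M.isThreeMultipede.isTwoMultipede.isTwoMinusMultipede
  rcases htwo.segments_or_feet _ habc with hs | hf
  · rwa [flip_of_not_foot g (not_foot_of_segment (hs (by simp : a ∈ _))),
      flip_of_not_foot g (not_foot_of_segment (hs (by simp : b ∈ _))),
      flip_of_not_foot g (not_foot_of_segment (hs (by simp : c ∈ _)))]
  obtain ⟨s, hs⟩ := hf (by simp : a ∈ _)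
  obtain ⟨t, ht⟩ := hf (by simp : b ∈ _)
  obtain ⟨r, hr⟩ := hf (by simp : c ∈ _)
  have hseg := htwo.segmentSet_mem _ habc hf
  have hset : segmentSet M.E {a, b, c} = {s, t, r} := by
    ext x
    constructor
    · rintro ⟨d, rfl | rfl | rfl, hd⟩
      · left; rw [← seg_eq hd, seg_eq hs]
      · right; left; rw [← seg_eq hd, seg_eq ht]
      · right; right; rw [Set.mem_singleton_iff, ← seg_eq hd, seg_eq hr]
    · rintro (rfl | rfl | rfl)
      exacts [⟨a, by simp, hs⟩, ⟨b, by simp, ht⟩, ⟨c, by simp, hr⟩]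
  rw [hset] at hseg
  have hmem : ({s, t, r} : Finset M.carrier) ∈ M.triples := by
    rw [mem_triples]
    push_cast
    refine ⟨hseg, ?_⟩
    rintro _ (rfl | rfl | rfl)
    exacts [⟨a, hs⟩, ⟨b, ht⟩, ⟨c, hr⟩]
  have hcard := card_of_mem_triples hmem
  -- The three segments are distinct because they form a hyperedge, which has three elements.
  have hst : s ≠ t := by
    rintro rfl
    have := Finset.card_le_two (a := s) (b := r)
    rw [Finset.insert_eq_of_mem (by simp)] at hcard
    omega
  have htr : t ≠ r := by
    rintro rfl
    have := Finset.card_le_two (a := s) (b := t)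
    rw [Finset.pair_eq_singleton] at hcard
    omega
  have hsr : s ≠ r := by
    rintro rfl
    have := Finset.card_le_two (a := s) (b := t)
    rw [Finset.insert_eq_of_mem (by simp)] at hcard
    have := Finset.card_le_two (a := t) (b := s)
    omega
  rw [seg_eq hs] at ha
  rw [seg_eq ht] at hb
  rw [seg_eq hr] at hc
  have hsum := hg _ hmem (by
    intro v hv
    simp only [Finset.mem_insert, Finset.mem_singleton] at hv
    rcases hv with rfl | rfl | rfl <;> assumption)
  rw [Finset.sum_insert (by simp [hst, hsr]), Finset.sum_pair htr] at hsum
  obtain ⟨h1, h2, h3⟩ := permuted_mem_edgeSet hs ht hr hst hsr htr habc hseg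
  simp only [flip, seg_eq hs, seg_eq ht, seg_eq hr]
  generalize g s = x at hsum ⊢
  generalize g t = y at hsum ⊢
  generalize g r = z at hsum ⊢
  have hcases : (x = 0 ∧ y = 0 ∧ z = 0) ∨ (x = 1 ∧ y = 1 ∧ z = 0) ∨ (x = 1 ∧ y = 0 ∧ z = 1) ∨
      (x = 0 ∧ y = 1 ∧ z = 1) := by
    revert x y z
    decide
  rcases hcases with ⟨rfl, rfl, rfl⟩ | ⟨rfl, rfl, rfl⟩ | ⟨rfl, rfl, rfl⟩ | ⟨rfl, rfl, rfl⟩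
  · simpa using habc
  · simpa using h1
  · simpa using h2
  · simpa using h3

/-! ### The back-and-forth system -/

open scoped Classical in
/-- On the variables in `V`, the assignment `τ` arises from `σ` by a flip which is compatible with
the hyperedges in the closure of the segments involved. -/
def FlipEquiv (V : Finset ℕ) (σ τ : ℕ → M.carrier) : Prop :=
  ∃ g : M.carrier → ZMod 2,
    SumsToZero M.triples (closure M.triples (V.image fun v => M.seg (σ v))) g ∧
    ∀ v ∈ V, τ v = flip g (σ v)

open scoped Classical in
theorem FlipEquiv.symm {V : Finset ℕ} {σ τ : ℕ → M.carrier} (h : FlipEquiv V σ τ) :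
    FlipEquiv V τ σ := by
  obtain ⟨g, hg, hτ⟩ := h
  refine ⟨g, ?_, fun v hv => by rw [hτ v hv, flip_flip]⟩
  have : (V.image fun v => M.seg (τ v)) = V.image fun v => M.seg (σ v) :=
    Finset.image_congr fun v hv => by
      show M.seg (τ v) = M.seg (σ v)
      rw [hτ v hv, seg_flip]
  rwa [this]

open scoped Classical in
-- Only the hyperedge relation needs the equations. One implication is enough, since `FlipEquiv` is
-- symmetric.
theorem FlipEquiv.relMap {V : Finset ℕ} {σ τ : ℕ → M.carrier} (h : FlipEquiv V σ τ) {n : ℕ}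
    (R : Multipede.language.Relations n) (xs : Fin n → ℕ) (hxs : ∀ i, xs i ∈ V)
    (hR : FirstOrder.Language.Structure.RelMap R fun i => σ (xs i)) :
    FirstOrder.Language.Structure.RelMap R fun i => τ (xs i) := by
  obtain ⟨g, hg, hτ⟩ := h
  have hseg : ∀ i, M.seg (σ (xs i)) ∈ closure M.triples (V.image fun v => M.seg (σ v)) :=
    fun i => subset_closure _ _ (Finset.mem_image_of_mem _ (hxs i))
  have : (fun i => τ (xs i)) = fun i => flip g (σ (xs i)) := funext fun i => hτ _ (hxs i)
  rw [this]
  cases R with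
  | edge => exact edge_flip g hR
  | hyperedge => exact hyperedge_flip hg (hseg 0) (hseg 1) (hseg 2) hR
  | lt => exact lt_flip g hR
  | mem => exact mem_flip g hR

open scoped Classical in
-- The back-and-forth step: one bijection answers all new values of `x` at once, as counting
-- quantifiers require. The old value of `x` is forgotten, and for each element `s` the solution on
-- the closure of the remaining segments is extended to the closure with `s` added.
theorem FlipEquiv.exists_equiv {V : Finset ℕ} {σ τ : ℕ → M.carrier} (h : FlipEquiv V σ τ) {l : ℕ}
    (hl : Meager M.triples l) (hV : V.card < l) {x : ℕ} (hx : x ∈ V) :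
    ∃ π : M.carrier ≃ M.carrier,
      ∀ a, FlipEquiv V (Function.update σ x a) (Function.update τ x (π a)) := by
  obtain ⟨g, hg, hτ⟩ := h
  set A := (V.erase x).image fun v => M.seg (σ v) with hA
  have himage : ∀ a, (V.image fun v => M.seg (Function.update σ x a v)) = insert (M.seg a) A := by
    intro a
    conv_lhs => rw [← Finset.insert_erase hx, Finset.image_insert, Function.update_self]
    congr 1
    refine Finset.image_congr fun v hv => ?_
    show M.seg (Function.update σ x a v) = _
    rw [Function.update_of_ne (Finset.ne_of_mem_erase hv)]
  have hAcard : A.card + 1 ≤ V.card := by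
    have h1 : A.card ≤ (V.erase x).card := Finset.card_image_le
    have h2 := Finset.card_erase_add_one hx
    omega
  have hsmall : ∀ s, (insert s A).card < l := fun s => by
    have := Finset.card_insert_le s A
    omega
  have hext : ∀ s, ∃ g' : M.carrier → ZMod 2,
      SumsToZero M.triples (closure M.triples (insert s A)) g' ∧
      ∀ v ∈ closure M.triples A, g' v = g v := by
    intro s
    refine exists_extension (fun h => card_of_mem_triples) hl (closed_closure _ A)
      (hg.mono (closure_mono _ (Finset.image_subset_image (Finset.erase_subset _ _)))) _
      (closure_mono _ (Finset.subset_insert _ _)) ?_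
    have := card_closure_le (fun h => card_of_mem_triples) hl _ (hsmall s)
    have := hsmall s
    omega
  choose g' hg' hgg' using hext
  -- The extension depends on `a` only through `seg a`, which flips preserve. Hence `π` is an
  -- involution although it uses many different flips.
  let π : M.carrier → M.carrier := fun a => flip (g' (M.seg a)) a
  have hπ : Function.Involutive π := fun a => by
    simp only [π, seg_flip, flip_flip]
  refine ⟨hπ.toPerm, fun a => ⟨g' (M.seg a), ?_, fun v hv => ?_⟩⟩
  · rw [himage]
    exact hg' _
  · by_cases hvx : v = x
    · subst hvx
      simp [π]
    · rw [Function.update_of_ne hvx, Function.update_of_ne hvx, hτ v hv]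
      refine flip_congr (hgg' _ _ (subset_closure _ _ ?_)).symm
      exact Finset.mem_image.2 ⟨v, Finset.mem_erase.2 ⟨hvx, hv⟩, rfl⟩

open scoped Classical in
/-- Flip equivalent assignments satisfy the same formulas with few variables. -/
theorem FlipEquiv.realize_iff {V : Finset ℕ} {l : ℕ} (hl : Meager M.triples l) (hV : V.card < l)
    (φ : CountingFormula.{0, w} Multipede.language) (hφ : φ.vars ⊆ (V : Set ℕ))
    {σ τ : ℕ → M.carrier} (h : FlipEquiv V σ τ) : φ.Realize σ ↔ φ.Realize τ := by
  induction φ generalizing σ τ with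
  | equal x y =>
    obtain ⟨g, -, hτ⟩ := h
    have hx : x ∈ V := hφ (Set.mem_insert _ _)
    have hy : y ∈ V := hφ (Set.mem_insert_of_mem _ rfl)
    have hinj : Function.Injective (flip g : M.carrier → M.carrier) :=
      Function.Involutive.injective (flip_flip g)
    simp only [CountingFormula.Realize]
    rw [hτ x hx, hτ y hy, hinj.eq_iff]
  | rel R xs =>
    have hxs : ∀ i, xs i ∈ V := fun i => hφ (Set.mem_range_self i)
    exact ⟨h.relMap R xs hxs, h.symm.relMap R xs hxs⟩
  | not φ ih => exact not_congr (ih hφ h)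
  | conj φ ih =>
    exact forall_congr' fun i => ih i ((Set.subset_iUnion (fun i => (φ i).vars) i).trans hφ) h
  | disj φ ih =>
    exact exists_congr fun i => ih i ((Set.subset_iUnion (fun i => (φ i).vars) i).trans hφ) h
  | ex x φ ih =>
    obtain ⟨π, hπ⟩ := h.exists_equiv hl hV (hφ (Set.mem_insert _ _))
    exact π.exists_congr fun a => ih ((Set.subset_insert _ _).trans hφ) (hπ a)
  | all x φ ih =>
    obtain ⟨π, hπ⟩ := h.exists_equiv hl hV (hφ (Set.mem_insert _ _))
    exact π.forall_congr fun a => ih ((Set.subset_insert _ _).trans hφ) (hπ a)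
  | exCount n x φ ih =>
    obtain ⟨π, hπ⟩ := h.exists_equiv hl hV (hφ (Set.mem_insert _ _))
    have himage : π '' {a | φ.Realize (Function.update σ x a)} =
        {a | φ.Realize (Function.update τ x a)} := by
      ext b
      obtain ⟨a, rfl⟩ := π.surjective b
      rw [π.injective.mem_set_image]
      exact ih ((Set.subset_insert _ _).trans hφ) (hπ a)
    simp only [CountingFormula.Realize]
    rw [← himage, π.injective.encard_image]

/-! ### Exchanging two feet, and the contradiction -/

open scoped Classical in
/-- The two feet of a segment can be exchanged. -/
theorem flipEquiv_of_swap {a s : M.carrier} (ha : M.E a s) {l : ℕ} (hl : Meager M.triples l)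
    (hl1 : 1 < l) (V : Finset ℕ) {σ τ : ℕ → M.carrier} (hσ : ∀ v, σ v = a ∨ σ v = M.partner a)
    (hτ : ∀ v, τ v = M.partner (σ v)) : FlipEquiv V σ τ := by
  have hseg : ∀ v, M.seg (σ v) = s := fun v => by
    rcases hσ v with h | h <;> rw [h]
    · exact seg_eq ha
    · rw [seg_partner, seg_eq ha]
  -- The constant 1 violates every equation, but the closure of at most one segment has at most two
  -- elements and contains no triple.
  refine ⟨fun _ => 1, fun h hh hsub => ?_, fun v _ => by simp [hτ v, flip]⟩
  have h1 : (V.image fun v => M.seg (σ v)).card ≤ 1 := by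
    refine Finset.card_le_one.2 fun x hx y hy => ?_
    obtain ⟨v, -, rfl⟩ := Finset.mem_image.1 hx
    obtain ⟨w, -, rfl⟩ := Finset.mem_image.1 hy
    rw [hseg, hseg]
  have h2 := card_closure_le (fun h => card_of_mem_triples) hl _ (h1.trans_lt hl1)
  have h3 := Finset.card_le_card hsub
  have := card_of_mem_triples hh
  omega

end Finite

end FourMultipede

open Multipede FourMultipede in
theorem mainTheorem5 :
    ∃ j : ℕ, ∀ (k : ℕ) (M : FourMultipede.{u}), Finite M.carrier → M.IsMeager (2 * (j + k)) →
      ∀ φ : CountingFormula.{0, w} Multipede.language, φ.IsLk k →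
        ¬ φ.DefinesLinearOrder M.carrier := by
  classical
  -- With `j = 1` the meagerness bound `2 * (1 + k)` exceeds both `k` and 1, also for `k = 0`.
  refine ⟨1, fun k M _ hM φ hφ => ?_⟩
  rintro ⟨x, y, r, ⟨hxy, hdef⟩, hr⟩
  let _ : Fintype M.carrier := Fintype.ofFinite M.carrier
  have hl := hM.meager_triples
  have hfin : φ.vars.Finite := Set.finite_of_encard_le_coe hφ
  have hV : hfin.toFinset.card ≤ k := by
    have : φ.vars.encard ≤ k := hφ
    rwa [hfin.encard_eq_coe_toFinset_card, Nat.cast_le] at this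
  obtain ⟨a, s, ha⟩ : ∃ a s, M.E a s := by
    obtain ⟨u, hu⟩ :=
      M.isThreeMultipede.isTwoMultipede.isTwoMinusMultipede.isThreeHypergraph.nonempty
    rw [← M.isOneMultipede.union_eq] at hu
    rcases hu with ⟨s, hs⟩ | ⟨a, ha⟩
    · exact ⟨u, s, hs⟩
    · exact ⟨a, u, ha⟩
  have hne := (partner_spec ha).1
  -- All variables take values in one pair of feet, so applying `partner` exchanges the values of
  -- `x` and `y`.
  let σ : ℕ → M.carrier := fun v => if v = x then a else M.partner a
  have hσx : σ x = a := if_pos rfl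
  have hσy : σ y = M.partner a := if_neg hxy.symm
  have hequiv : FlipEquiv hfin.toFinset σ fun v => M.partner (σ v) :=
    flipEquiv_of_swap ha hl (show 1 < 2 * (1 + k) by omega) _
      (fun v => by by_cases hv : v = x <;> simp [σ, hv]) fun _ => rfl
  have hswap := hequiv.realize_iff hl (by omega) φ (by rw [hfin.coe_toFinset])
  rw [hdef, hdef, hσx, hσy, partner_partner] at hswap
  rcases hr with hr | hr
  · rcases hr.toTrichotomous.trichotomous a (M.partner a) with h
    by_cases hab : r a (M.partner a)
    · exact hr.irrefl _ (hr.trans _ _ _ hab (hswap.1 hab))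
    · exact hne (h hab (fun h' => hab (hswap.2 h'))).symm
  · rcases hr.total a (M.partner a) with h | h
    · exact hne (hr.antisymm _ _ (hswap.1 h) h)
    · exact hne (hr.antisymm _ _ h (hswap.2 h))
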